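/- Let $\mathbb G=(A,E)$ be a finite digraph (loops allowed, $E\subseteq A\times A$). Suppose that $\mathbb G$ is strongly connected, i.e. for all $u,v\in A$ there is a directed walk (of some length $\ge 0$) from $u$ to $v$; that $\mathbb G$ has algebraic length $1$, i.e. there is no digraph homomorphism from $\mathbb G$ to a directed cycle of length greater than one; and that $\mathbb G$ is compatible with a Taylor operation $t\colon A^n\to A$, i.e. whenever $u_i\to v_i$ is an edge for every $i\in\{0,\dots,n-1\}$, so is $t(u_0,\dots,u_{n-1})\to t(v_0,\dots,v_{n-1})$. Then $\mathbb G$ has a loop, i.e. there is $a\in A$ with $(a,a)\in E$. Here $t\colon A^n\to A$ is called a Taylor operation if it is idempotent, i.e. $t(x,\dots,x)=x$ for all $x\in A$, and there are words $p^0,q^0,\dots,p^{n-1},q^{n-1}\in\{x,y\}^n$ in two variable symbols $x,y$, such that for every $i\in\{0,\dots,n-1\}$ the $i$-th letter of $p^i$ is $x$, the $i$-th letter of $q^i$ is $y$ (letters numbered from $0$), and the equation $t(p^i_0,\dots,p^i_{n-1})=t(q^i_0,\dots,q^i_{n-1})$ holds for all values of $x,y$ in $A$. -/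

import Mathlib

namespace LoopLemma

/-- An `n`-ary operation on `A` is idempotent if `t(x, x, …, x) = x` for every `x`. -/
def IsIdempotentOp {A : Type*} {n : ℕ} (t : (Fin n → A) → A) : Prop :=
  ∀ x : A, t (fun _ => x) = x

/-- `t` satisfies the system of equations, one for each coordinate `i`, in which position `j` of
the left (right) side of the `i`-th equation carries the variable `x` if `l i j` (resp. `r i j`)
is `true`, and the variable `y` otherwise. -/
def SatisfiesSystem {A : Type*} {n : ℕ} (t : (Fin n → A) → A)
    (l r : Fin n → Fin n → Bool) : Prop :=
  ∀ (i : Fin n) (x y : A),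
    t (fun j => if l i j then x else y) = t (fun j => if r i j then x else y)

/-- A Taylor operation: an idempotent operation that satisfies some system of equations whose
`i`-th member has the form `t(?, …, x, …, ?) ≈ t(?, …, y, …, ?)`, with the displayed `x` and `y`
at position `i` and every question mark standing for either `x` or `y`. -/
def IsTaylorOp {A : Type*} {n : ℕ} (t : (Fin n → A) → A) : Prop :=
  (∃ l r : Fin n → Fin n → Bool,
    (∀ i, l i i = true) ∧ (∀ i, r i i = false) ∧ SatisfiesSystem t l r) ∧
  IsIdempotentOp t

/-- The edge relation of `G` is preserved by the operation `t` applied coordinatewise. -/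
def Compatible {A : Type*} {n : ℕ} (G : Digraph A) (t : (Fin n → A) → A) : Prop :=
  ∀ u v : Fin n → A, (∀ i, G.Adj (u i) (v i)) → G.Adj (t u) (t v)

/-- There is a directed walk (of some length `≥ 0`) from any vertex to any vertex. -/
def StronglyConnected {A : Type*} (G : Digraph A) : Prop :=
  ∀ u v : A, Relation.ReflTransGen G.Adj u v

/-- The directed cycle of length `m ≥ 1`: vertices `ℤ/m`, edges `i → i + 1`. -/
def directedCycle (m : ℕ) : Digraph (ZMod m) where
  Adj i j := j = i + 1

/-- `f` is a homomorphism of digraphs. -/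
def IsDigraphHom {A B : Type*} (G : Digraph A) (H : Digraph B) (f : A → B) : Prop :=
  ∀ u v : A, G.Adj u v → H.Adj (f u) (f v)

/-- Algebraic length `1`: no homomorphism to a directed cycle of length greater than one. -/
def HasAlgebraicLengthOne {A : Type*} (G : Digraph A) : Prop :=
  ∀ m : ℕ, 1 < m → ¬ ∃ f : A → ZMod m, IsDigraphHom G (directedCycle m) f

/-- `G` has an edge from some vertex to itself. -/
def HasLoop {A : Type*} (G : Digraph A) : Prop :=
  ∃ a : A, G.Adj a a

end LoopLemma

namespace LoopLemma

variable {A : Type*}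

/-! Strong connectedness and algebraic length 1 make the lengths of closed walks through a vertex
coprime, so some power E^N with N > 0 is full. It suffices to find a loop or a proper nonempty
t-closed subset on which a positive power of the restricted edge relation is again full; induction
on |A| then finishes.

If A has a proper absorbing subset, fullness of a power descends to an absorbing subset without
sources or sinks: the absorbing operation is applied to tuples of walks, with one coordinate at a
time allowed to leave the subset (`AbsorbsVia.exists_relPow`, `exists_subset_of_absorbs`).

If A is absorption-free, take the least k > 0 with E^k full; k = 1 gives a loop. Otherwise S =
E^(k-1) is not full, so by the absorption theorem `LinkedOn.full` it is not linked, and a link class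
L is proper. Let C = S[L]. Shrinking to absorption-free F ⊆ L and D ⊆ C gives F × D ⊆ S, while every
vertex of A keeps a successor in F and a predecessor in D. Hence some d in D has closed walks of
lengths k and k + 1 inside L ∩ C, and its strong component there is the wanted subset
(`exists_loop_or_subset`).

The Taylor identities themselves are exploited only in `IsTaylorOp.eq_of_absFree`. -/

/-- `relPow E k x y`: there is an `E`-walk of length `k` from `x` to `y`. -/
def relPow (E : A → A → Prop) : ℕ → A → A → Prop
  | 0 => Eq
  | k + 1 => fun x y => ∃ z, relPow E k x z ∧ E z y

/-- The restriction of a binary relation to a set. -/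
def restr (E : A → A → Prop) (P : Set A) (x y : A) : Prop := E x y ∧ x ∈ P ∧ y ∈ P

/-- The image of a set under a binary relation. -/
def relImage (R : A → A → Prop) (P : Set A) : Set A := {y | ∃ x ∈ P, R x y}

/-! ### Walks and powers of a relation -/

section Walks

variable {E E' : A → A → Prop}

theorem relPow_one {x y : A} : relPow E 1 x y ↔ E x y := by
  simp [relPow]

theorem relPow_add {m n : ℕ} {x y z : A} (h₁ : relPow E m x y) (h₂ : relPow E n y z) :
    relPow E (m + n) x z := by
  induction n generalizing z with
  | zero => cases h₂; exact h₁
  | succ n ih =>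
    obtain ⟨w, hw, hwz⟩ := h₂
    exact ⟨w, ih hw, hwz⟩

theorem exists_of_relPow_add {m n : ℕ} {x z : A} (h : relPow E (m + n) x z) :
    ∃ y, relPow E m x y ∧ relPow E n y z := by
  induction n generalizing z with
  | zero => exact ⟨z, h, rfl⟩
  | succ n ih =>
    obtain ⟨w, hw, hwz⟩ := h
    obtain ⟨y, hy, hyw⟩ := ih hw
    exact ⟨y, hy, w, hyw, hwz⟩

theorem relPow_cons {n : ℕ} {x y z : A} (h₁ : E x y) (h₂ : relPow E n y z) :
    relPow E (n + 1) x z := by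
  rw [add_comm]
  exact relPow_add (relPow_one.2 h₁) h₂

theorem relPow.mono (h : ∀ x y, E x y → E' x y) {n : ℕ} {x y : A} (hw : relPow E n x y) :
    relPow E' n x y := by
  induction n generalizing y with
  | zero => exact hw
  | succ n ih =>
    obtain ⟨w, hw, hwz⟩ := hw
    exact ⟨w, ih hw, h _ _ hwz⟩

theorem relPow.reflTransGen {n : ℕ} {x y : A} (h : relPow E n x y) :
    Relation.ReflTransGen E x y := by
  induction n generalizing y with
  | zero => cases h; exact .refl
  | succ n ih =>
    obtain ⟨w, hw, hwz⟩ := h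
    exact (ih hw).tail hwz

theorem exists_relPow_of_reflTransGen {x y : A} (h : Relation.ReflTransGen E x y) :
    ∃ n, relPow E n x y := by
  induction h with
  | refl => exact ⟨0, rfl⟩
  | tail _ h ih =>
    obtain ⟨n, hn⟩ := ih
    exact ⟨n + 1, _, hn, h⟩

theorem relPow.pad {y : A} (hy : E y y) {m n : ℕ} (hmn : m ≤ n) {x : A} (h : relPow E m x y) :
    relPow E n x y := by
  induction n, hmn using Nat.le_induction with
  | base => exact h
  | succ n _ ih => exact ⟨y, ih, hy⟩

/-- A walk all of whose intermediate vertices lie in `Y` is a walk of the restriction to `Y`. -/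
theorem relPow.restr {Y : Set A} {s : ℕ} {x y : A}
    (hY : ∀ i z, i ≤ s → relPow E i x z → relPow E (s - i) z y → z ∈ Y)
    (h : relPow E s x y) : relPow (restr E Y) s x y := by
  suffices H : ∀ i z, i ≤ s → relPow E i x z → relPow E (s - i) z y →
      relPow (LoopLemma.restr E Y) i x z from
    H s y le_rfl h (by rw [Nat.sub_self]; rfl)
  intro i
  induction i with
  | zero => exact fun z _ h _ => h
  | succ i ih =>
    rintro z hi ⟨w, hw, hwz⟩ hz
    have hw' : relPow E (s - i) w y := by
      have : s - i = s - (i + 1) + 1 := by omega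
      rw [this]
      exact relPow_cons hwz hz
    exact ⟨w, ih w (by omega) hw hw', hwz, hY i w (by omega) hw hw',
      hY (i + 1) z hi ⟨w, hw, hwz⟩ hz⟩

theorem exists_relPow_to (P : Set A) (h : ∀ x ∈ P, ∃ y ∈ P, E x y) (n : ℕ) :
    ∀ x ∈ P, ∃ y ∈ P, relPow (restr E P) n x y := by
  induction n with
  | zero => exact fun x hx => ⟨x, hx, rfl⟩
  | succ n ih =>
    intro x hx
    obtain ⟨y, hy, hxy⟩ := ih x hx
    obtain ⟨z, hz, hyz⟩ := h y hy
    exact ⟨z, hz, y, hxy, hyz, hy, hz⟩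

theorem exists_relPow_from (P : Set A) (h : ∀ y ∈ P, ∃ x ∈ P, E x y) (n : ℕ) :
    ∀ y ∈ P, ∃ x ∈ P, relPow (restr E P) n x y := by
  induction n with
  | zero => exact fun x hx => ⟨x, hx, rfl⟩
  | succ n ih =>
    intro y hy
    obtain ⟨z, hz, hzy⟩ := h y hy
    obtain ⟨x, hx, hxz⟩ := ih z hz
    exact ⟨x, hx, z, hxz, hzy, hz, hy⟩

variable [Finite A]

/-- Loops at the endpoint pad all walks to one length. This makes reachability in a reflexive
relation a single power, hence preserved by t. -/
theorem exists_uniform_relPow (E : A → A → Prop) :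
    ∃ N, ∀ x y, E y y → Relation.ReflTransGen E x y → relPow E N x y := by
  classical
  have := Fintype.ofFinite A
  have h : ∀ p : A × A, ∃ n, Relation.ReflTransGen E p.1 p.2 → relPow E n p.1 p.2 := by
    intro p
    by_cases hp : Relation.ReflTransGen E p.1 p.2
    · obtain ⟨n, hn⟩ := exists_relPow_of_reflTransGen hp
      exact ⟨n, fun _ => hn⟩
    · exact ⟨0, fun h => absurd h hp⟩
  choose n hn using h
  refine ⟨Finset.univ.sup n, fun x y hy hxy => ?_⟩
  exact (hn (x, y) hxy).pad hy (Finset.le_sup (f := n) (Finset.mem_univ _))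

/-- In a strong component where the closed walks through `d` have coprime lengths, any two vertices
are joined by walks of one common length. -/
theorem exists_common_length (E : A → A → Prop) (d : A)
    (hd : Nat.setGcd {m | relPow E m d d} = 1) :
    ∃ N, 0 < N ∧ ∀ u v, Relation.ReflTransGen E u d → Relation.ReflTransGen E d v →
      relPow E N u v := by
  classical
  have := Fintype.ofFinite A
  -- An additive submonoid of ℕ contains every large multiple of the gcd of its generators.
  obtain ⟨n₀, hn₀⟩ := Nat.exists_mem_closure_of_ge {m | relPow E m d d}
  have hcl : ∀ m ≥ n₀, relPow E m d d := by
    intro m hm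
    have := hn₀ m hm (by rw [hd]; exact one_dvd m)
    clear hm
    induction this using AddSubmonoid.closure_induction with
    | mem x hx => exact hx
    | zero => rfl
    | add x y _ _ hx hy => exact relPow_add hx hy
  have h₁ : ∀ u, ∃ n, Relation.ReflTransGen E u d → relPow E n u d := by
    intro u
    by_cases hp : Relation.ReflTransGen E u d
    · obtain ⟨n, hn⟩ := exists_relPow_of_reflTransGen hp
      exact ⟨n, fun _ => hn⟩
    · exact ⟨0, fun h => absurd h hp⟩
  have h₂ : ∀ u, ∃ n, Relation.ReflTransGen E d u → relPow E n d u := by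
    intro u
    by_cases hp : Relation.ReflTransGen E d u
    · obtain ⟨n, hn⟩ := exists_relPow_of_reflTransGen hp
      exact ⟨n, fun _ => hn⟩
    · exact ⟨0, fun h => absurd h hp⟩
  choose p hp using h₁
  choose q hq using h₂
  refine ⟨Finset.univ.sup p + n₀ + Finset.univ.sup q + 1, by omega, fun u v hu hv => ?_⟩
  have hpu : p u ≤ Finset.univ.sup p := Finset.le_sup (Finset.mem_univ u)
  have hqv : q v ≤ Finset.univ.sup q := Finset.le_sup (Finset.mem_univ v)
  obtain ⟨m, hm, he⟩ : ∃ m ≥ n₀, Finset.univ.sup p + n₀ + Finset.univ.sup q + 1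
      = p u + m + q v :=
    ⟨Finset.univ.sup p + n₀ + Finset.univ.sup q + 1 - p u - q v, by omega, by omega⟩
  rw [he]
  exact relPow_add (relPow_add (hp u hu) (hcl m hm)) (hq v hv)

/-- A nonempty set with property `C` in which every vertex has a predecessor contains such a set in
which every vertex also has a successor. -/
theorem exists_smooth_subset (E : A → A → Prop) (C : Set A → Prop)
    (hC : ∀ P, C P → (∃ x ∈ P, ∃ y ∈ P, E x y) → C {x ∈ P | ∃ y ∈ P, E x y})
    {P : Set A} (hP : C P) (hne : P.Nonempty) (hpred : ∀ y ∈ P, ∃ x ∈ P, E x y) :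
    ∃ K ⊆ P, C K ∧ K.Nonempty ∧ (∀ y ∈ K, ∃ x ∈ K, E x y) ∧ ∀ x ∈ K, ∃ y ∈ K, E x y := by
  induction h : P.ncard using Nat.strong_induction_on generalizing P with
  | _ m ih =>
    by_cases hs : ∀ x ∈ P, ∃ y ∈ P, E x y
    · exact ⟨P, subset_rfl, hP, hne, hpred, hs⟩
    · push Not at hs
      obtain ⟨a, ha, hna⟩ := hs
      set Q : Set A := {x ∈ P | ∃ y ∈ P, E x y} with hQ
      have hex : ∃ x ∈ P, ∃ y ∈ P, E x y := by
        obtain ⟨y, hy⟩ := hne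
        obtain ⟨x, hx, hxy⟩ := hpred y hy
        exact ⟨x, hx, y, hy, hxy⟩
      have hlt : Q.ncard < m := by
        rw [← h]
        refine Set.ncard_lt_ncard ⟨fun x hx => hx.1, fun hsub => ?_⟩
        obtain ⟨-, y, hy, hay⟩ := hsub ha
        exact hna y hy hay
      obtain ⟨K, hK, hrest⟩ := ih _ hlt (P := Q) (hC P hP hex)
        (by obtain ⟨x, hx, hy⟩ := hex; exact ⟨x, hx, hy⟩)
        -- A predecessor x of y has y as successor, so deleting sinks removes no needed predecessor.
        (by
          rintro y ⟨hy, -⟩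
          obtain ⟨x, hx, hxy⟩ := hpred y hy
          exact ⟨x, ⟨hx, y, hy, hxy⟩, hxy⟩) rfl
      exact ⟨K, hK.trans fun x hx => hx.1, hrest⟩

end Walks

/-! ### Clones and absorption -/

/-- The operation `f` preserves the binary relation `R`. -/
def Preserves {ι : Type*} (f : (ι → A) → A) (R : A → A → Prop) : Prop :=
  ∀ u v, (∀ i, R (u i) (v i)) → R (f u) (f v)

/-- `f` preserves all binary relations preserved by `t`. -/
def InClone {κ ι : Type*} (t : (κ → A) → A) (f : (ι → A) → A) : Prop :=
  ∀ R : A → A → Prop, Preserves t R → Preserves f R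

/-- The set `P` is closed under the operation `t`. -/
def ClosedUnder {ι : Type*} (t : (ι → A) → A) (P : Set A) : Prop :=
  ∀ u, (∀ i, u i ∈ P) → t u ∈ P

/-- `P ⊆ Q`, and `f` takes values in `P` whenever all its arguments but one are in `P` and the
remaining one is in `Q`. -/
structure AbsorbsVia {ι : Type*} (f : (ι → A) → A) (P Q : Set A) : Prop where
  sub : P ⊆ Q
  absorb : ∀ u i, u i ∈ Q → (∀ j, j ≠ i → u j ∈ P) → f u ∈ P

/-- `P` is a nonempty `t`-closed set that absorbs `Q` by an operation in the clone of `t`. -/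
def Absorbs {κ : Type*} (t : (κ → A) → A) (P Q : Set A) : Prop :=
  P.Nonempty ∧ ClosedUnder t P ∧ ∃ (ι : Type) (_ : Finite ι) (_ : Nonempty ι) (f : (ι → A) → A),
    InClone t f ∧ AbsorbsVia f P Q

/-- `Q` has no proper absorbing subset. -/
def AbsFree {κ : Type*} (t : (κ → A) → A) (Q : Set A) : Prop :=
  ∀ P, Absorbs t P Q → P = Q

section Clone

variable {κ ι : Type*} {t : (κ → A) → A} {f : (ι → A) → A} {R : A → A → Prop} {P Q : Set A}

theorem InClone.refl (t : (κ → A) → A) : InClone t t := fun _ h => h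

theorem InClone.closedUnder (h : InClone t f) (hP : ClosedUnder t P) : ClosedUnder f P :=
  -- A set is encoded as a binary relation ignoring its second argument.
  fun u hu => h (fun x _ => x ∈ P) (fun v _ hv => hP v hv) u u hu

theorem InClone.const (h : InClone t f) (ht : ∀ x, t (fun _ => x) = x) (x : A) :
    f (fun _ => x) = x := by
  refine h.closedUnder (P := {x}) (fun u hu => ?_) _ fun _ => rfl
  have : u = fun _ => x := funext hu
  rw [this, ht]
  rfl

theorem Preserves.swap (h : Preserves t R) : Preserves t (fun x y => R y x) :=
  fun u v huv => h v u huv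

theorem Preserves.relPow (h : Preserves t R) (n : ℕ) : Preserves t (relPow R n) := by
  induction n with
  | zero =>
    intro u v huv
    have : u = v := funext huv
    rw [this]
    rfl
  | succ n ih =>
    intro u v huv
    choose w hw hwv using huv
    exact ⟨t w, ih u w hw, h w v hwv⟩

theorem Preserves.restr (h : Preserves t R) (hP : ClosedUnder t P) : Preserves t (restr R P) :=
  fun u v huv => ⟨h u v fun i => (huv i).1, hP u fun i => (huv i).2.1, hP v fun i => (huv i).2.2⟩

theorem Preserves.image (h : Preserves t R) (hP : ClosedUnder t P) :
    ClosedUnder t (relImage R P) := by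
  intro v hv
  choose u hu huv using hv
  exact ⟨t u, hP u hu, h u v huv⟩

theorem Preserves.closedUnder_image (h : Preserves t R) (ht : ∀ x, t (fun _ => x) = x) (a : A) :
    ClosedUnder t {y | R a y} := by
  intro v hv
  have := h (fun _ => a) v hv
  rwa [ht] at this

theorem ClosedUnder.inter (hP : ClosedUnder t P) (hQ : ClosedUnder t Q) :
    ClosedUnder t (P ∩ Q) :=
  fun u hu => ⟨hP u fun i => (hu i).1, hQ u fun i => (hu i).2⟩

theorem AbsorbsVia.image (hf : Preserves f R) (h : AbsorbsVia f P Q) :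
    AbsorbsVia f (relImage R P) (relImage R Q) where
  sub := fun y ⟨x, hx, hxy⟩ => ⟨x, h.sub hx, hxy⟩
  absorb := by
    classical
    intro v i hi hj
    obtain ⟨a, ha, hai⟩ := hi
    have : ∀ j, ∃ x, (j ≠ i → x ∈ P) ∧ (j = i → x = a) ∧ R x (v j) := by
      intro j
      by_cases hji : j = i
      · exact ⟨a, fun h => absurd hji h, fun _ => rfl, hji ▸ hai⟩
      · obtain ⟨x, hx, hxy⟩ := hj j hji
        exact ⟨x, fun _ => hx, fun h => absurd h hji, hxy⟩
    choose u hu hui huv using this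
    exact ⟨f u, h.absorb u i (by rw [hui i rfl]; exact ha) hu, hf u v huv⟩

theorem Absorbs.image (hR : Preserves t R) (h : Absorbs t P Q) (hne : (relImage R P).Nonempty) :
    Absorbs t (relImage R P) (relImage R Q) := by
  obtain ⟨-, hP, ι, hι, hι', f, hf, habs⟩ := h
  exact ⟨hne, hR.image hP, ι, hι, hι', f, hf, habs.image (hf R hR)⟩

theorem Absorbs.subset (h : Absorbs t P Q) : P ⊆ Q := by
  obtain ⟨-, -, _, _, _, _, _, h⟩ := h
  exact h.sub

theorem AbsFree.eq_univ_of_image (h : AbsFree t (Set.univ : Set A)) (hR : Preserves t R)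
    (hPQ : Absorbs t P Q) (hQ : relImage R Q = Set.univ) (hne : (relImage R P).Nonempty) :
    relImage R P = Set.univ := by
  have := hPQ.image hR hne
  rw [hQ] at this
  exact h _ this

/-- A coordinatewise transition from walks inside `P` to walks of the whole set. -/
theorem AbsorbsVia.relPow_window (h : AbsorbsVia f P Q) (hf : Preserves f R)
    (hR : ∀ x y, R x y → x ∈ Q ∧ y ∈ Q) (i : ι) {N : ℕ} {u v : ι → A}
    (hj : ∀ j, j ≠ i → relPow (restr R P) N (u j) (v j)) (hi : relPow R N (u i) (v i)) :
    relPow (restr R P) N (f u) (f v) := by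
  classical
  induction N generalizing v with
  | zero =>
    have : u = v := funext fun j => by
      by_cases hji : j = i
      · subst hji; exact hi
      · exact hj j hji
    rw [this]
    rfl
  | succ N ih =>
    obtain ⟨b, hb, hbv⟩ := hi
    have : ∀ j, ∃ x, (j ≠ i → relPow (restr R P) N (u j) x ∧ x ∈ P ∧ v j ∈ P) ∧
        (j = i → x = b) ∧ R x (v j) := by
      intro j
      by_cases hji : j = i
      · exact ⟨b, fun h => absurd hji h, fun _ => rfl, hji ▸ hbv⟩
      · obtain ⟨x, hx, hxv, hxP, hvP⟩ := hj j hji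
        exact ⟨x, fun _ => ⟨hx, hxP, hvP⟩, fun h => absurd h hji, hxv⟩
    choose w hw hwi hwv using this
    refine ⟨f w, ih (fun j hji => (hw j hji).1) (by rw [hwi i rfl]; exact hb), hf w v hwv, ?_, ?_⟩
    · exact h.absorb w i (by rw [hwi i rfl]; exact (hR _ _ hbv).1) fun j hji => (hw j hji).2.1
    · exact h.absorb v i (hR _ _ hbv).2 fun j hji => (hw j hji).2.2

/-- If walks of one common length join all vertices of `Q` and `P` absorbs `Q`, then, inside `P`,
walks of one common length join all vertices of `P`. -/
theorem AbsorbsVia.exists_relPow [Finite ι] [Nonempty ι] (h : AbsorbsVia f P Q)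
    (hf : Preserves f R) (hidem : ∀ x, f (fun _ => x) = x) (hR : ∀ x y, R x y → x ∈ Q ∧ y ∈ Q)
    {N : ℕ} (hN : 0 < N) (hfull : ∀ x ∈ Q, ∀ y ∈ Q, relPow R N x y)
    (hsucc : ∀ x ∈ P, ∃ y ∈ P, R x y) (hpred : ∀ y ∈ P, ∃ x ∈ P, R x y) :
    ∃ M, 0 < M ∧ ∀ x ∈ P, ∀ y ∈ P, relPow (restr R P) M x y := by
  classical
  have := Fintype.ofFinite ι
  -- J collects the coordinates whose endpoints are not yet joined inside P; each costs one window
  -- of N steps.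
  suffices H : ∀ J : Finset ι, ∀ u v : ι → A, (∀ j, u j ∈ P) → (∀ j, v j ∈ P) →
      (∀ j, j ∉ J → relPow (restr R P) (J.card * N) (u j) (v j)) →
      relPow (restr R P) (J.card * N) (f u) (f v) by
    refine ⟨(Finset.univ : Finset ι).card * N, Nat.mul_pos (Finset.card_pos.2 Finset.univ_nonempty) hN,
      fun x hx y hy => ?_⟩
    have := H Finset.univ (fun _ => x) (fun _ => y) (fun _ => hx) (fun _ => hy)
      fun j hj => absurd (Finset.mem_univ j) hj
    rwa [hidem, hidem] at this
  intro J
  induction J using Finset.induction_on with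
  | empty =>
    intro u v _ _ huv
    have : u = v := funext fun j => by simpa [relPow] using huv j (Finset.notMem_empty j)
    rw [this]
    simp [relPow]
  | insert i J hiJ ih =>
    intro u v hu hv huv
    rw [Finset.card_insert_of_notMem hiJ, Nat.succ_mul, add_comm] at huv ⊢
    -- The tuple after the first window: coordinate i may leave P on its way there, the rest of J
    -- wanders inside P, and the others follow their given walks.
    have : ∀ j, ∃ x ∈ P, (j ≠ i → relPow (restr R P) N (u j) x) ∧
        (j ∉ J → relPow (restr R P) (J.card * N) x (v j)) := by
      intro j
      by_cases hji : j = i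
      · obtain ⟨x, hx, hxv⟩ := exists_relPow_from P hpred (J.card * N) (v j) (hv j)
        exact ⟨x, hx, fun h => absurd hji h, fun _ => hxv⟩
      · by_cases hjJ : j ∈ J
        · obtain ⟨x, hx, hux⟩ := exists_relPow_to P hsucc N (u j) (hu j)
          exact ⟨x, hx, fun _ => hux, fun h => absurd hjJ h⟩
        · obtain ⟨x, hux, hxv⟩ := exists_of_relPow_add
            (huv j (by simp [hji, hjJ]))
          refine ⟨x, ?_, fun _ => hux, fun _ => hxv⟩
          cases N with
          | zero => exact absurd hN (lt_irrefl _)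
          | succ N =>
            obtain ⟨_, _, _, _, hxP⟩ := hux
            exact hxP
    choose w hwP hw₁ hw₂ using this
    exact relPow_add (h.relPow_window hf hR i hw₁ (hfull _ (h.sub (hu i)) _ (h.sub (hwP i))))
      (ih w v hwP hv hw₂)

end Clone

/-! ### Transitive operations from the Taylor identities -/

section Transitive

variable {n : ℕ} {t : (Fin n → A) → A}

/-- Identifying variables as in the i-th identity gives a binary operation. Its left form has x at
position i, its right form y, so either argument in Z forces the value into Z: Z absorbs Y. -/
theorem IsTaylorOp.eq_of_absFree (ht : IsTaylorOp t) {Y Z : Set A}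
    (hfree : AbsFree t Y) (hZY : Z ⊆ Y) (hZ : Z.Nonempty) (i : Fin n)
    (hcl : ∀ u, (∀ j, u j ∈ Y) → u i ∈ Z → t u ∈ Z) : Z = Y := by
  obtain ⟨⟨l, r, hl, hr, heq⟩, -⟩ := ht
  refine hfree Z ⟨hZ, fun u hu => hcl u (fun j => hZY (hu j)) (hu i), Bool, inferInstance,
    inferInstance, fun u => t fun j => if l i j then u true else u false, ?_, hZY, ?_⟩
  · intro R hR u v huv
    refine hR _ _ fun j => ?_
    split
    · exact huv true
    · exact huv false
  · intro u b hb hj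
    have hY' : ∀ c, u c ∈ Y := by
      intro c
      by_cases hc : c = b
      · exact hc ▸ hb
      · exact hZY (hj c hc)
    cases b with
    | false =>
      refine hcl _ (fun j => ?_) ?_
      · split <;> exact hY' _
      · simpa [hl i] using hj true (by simp)
    | true =>
      rw [heq i (u true) (u false)]
      refine hcl _ (fun j => ?_) ?_
      · split <;> exact hY' _
      · simpa [hr i] using hj false (by simp)

/-- The values of `f` on tuples in `Y` with the entry `b` at position `i`. -/
def orbitAt {ι : Type*} (f : (ι → A) → A) (Y : Set A) (i : ι) (b : A) : Set A :=
  {c | ∃ u, (∀ j, u j ∈ Y) ∧ u i = b ∧ f u = c}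

/-- Composing t with f on disjoint blocks strictly enlarges every orbit that is not yet all of Y:
otherwise the orbit would be a proper subset excluded by `IsTaylorOp.eq_of_absFree`. -/
theorem exists_transitive [Finite A] [Nonempty (Fin n)] (ht : IsTaylorOp t) {Y : Set A}
    (hY : ClosedUnder t Y) (hfree : AbsFree t Y) :
    ∃ (ι : Type) (_ : Finite ι) (_ : Nonempty ι) (f : (ι → A) → A), InClone t f ∧
      ∀ i, ∀ b ∈ Y, ∀ c ∈ Y, ∃ u, (∀ j, u j ∈ Y) ∧ u i = b ∧ f u = c := by
  have hidem : ∀ x, t (fun _ => x) = x := ht.2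
  have hsub : ∀ {ι : Type} {f : (ι → A) → A}, InClone t f → ∀ i b, orbitAt f Y i b ⊆ Y := by
    rintro ι f hf i b c ⟨u, hu, -, rfl⟩
    exact hf.closedUnder hY u hu
  suffices H : ∀ k : ℕ, ∃ (ι : Type) (_ : Finite ι) (_ : Nonempty ι) (f : (ι → A) → A),
      InClone t f ∧ ∀ i, ∀ b ∈ Y, k ≤ (orbitAt f Y i b).ncard ∨ orbitAt f Y i b = Y by
    obtain ⟨ι, hι, hι', f, hf, h⟩ := H (Y.ncard + 1)
    refine ⟨ι, hι, hι', f, hf, fun i b hb c hc => ?_⟩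
    rcases h i b hb with h | h
    · have := Set.ncard_le_ncard (hsub hf i b)
      omega
    · rw [← h] at hc
      exact hc
  intro k
  induction k with
  | zero => exact ⟨Fin n, inferInstance, inferInstance, t, .refl t, fun _ _ _ => .inl (Nat.zero_le _)⟩
  | succ k ih =>
    obtain ⟨ι, hι, hι', f, hf, h⟩ := ih
    refine ⟨Fin n × ι, inferInstance, inferInstance,
      fun u => t fun a => f fun j => u (a, j), ?_, ?_⟩
    · intro R hR u v huv
      exact hR _ _ fun a => hf R hR _ _ fun j => huv (a, j)
    · rintro ⟨a, j⟩ b hb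
      set O := orbitAt (fun u : Fin n × ι → A => t fun a => f fun j => u (a, j)) Y (a, j) b with hO
      have hstep : ∀ w : Fin n → A, (∀ i, w i ∈ Y) → w a ∈ orbitAt f Y j b → t w ∈ O := by
        classical
        rintro w hw ⟨u, hu, hub, huw⟩
        refine ⟨fun p => if p.1 = a then u p.2 else w p.1, fun p => ?_, by simpa using hub, ?_⟩
        · dsimp only
          split
          exacts [hu _, hw _]
        · dsimp only
          congr 1
          funext i
          by_cases hi : i = a
          · simp [hi, huw]
          · simp [hi, hf.const hidem]
      have hle : orbitAt f Y j b ⊆ O := by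
        intro c hc
        have := hstep (fun _ => c) (fun _ => hsub hf j b hc) hc
        rwa [hidem] at this
      have hOY : O ⊆ Y := by
        rintro c ⟨u, hu, -, rfl⟩
        exact hY _ fun a => hf.closedUnder hY _ fun j => hu (a, j)
      by_cases hfull : orbitAt f Y j b = Y
      · right
        exact hOY.antisymm (hfull ▸ hle)
      · left
        have hk := (h j b hb).resolve_right hfull
        have hne : (orbitAt f Y j b).Nonempty := ⟨b, fun _ => b, fun _ => hb, rfl, hf.const hidem b⟩
        have : ∃ w : Fin n → A, (∀ i, w i ∈ Y) ∧ w a ∈ orbitAt f Y j b ∧ t w ∉ orbitAt f Y j b := by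
          by_contra! hcon
          exact hfull (ht.eq_of_absFree hfree (hsub hf j b) hne a hcon)
        obtain ⟨w, hw, hwa, hwn⟩ := this
        have : (orbitAt f Y j b).ncard < O.ncard :=
          Set.ncard_lt_ncard ⟨hle, fun hsub => hwn (hsub (hstep w hw hwa))⟩
        omega

/-- A relation between absorption-free sets with an element related to everything is full. -/
theorem full_of_center [Finite A] [Nonempty (Fin n)] (ht : IsTaylorOp t) {T : A → A → Prop}
    (hT : Preserves t T) {X Y : Set A} (hX : ClosedUnder t X) (hY : ClosedUnder t Y)
    (hXf : AbsFree t X) (hYf : AbsFree t Y) (htot : ∀ x ∈ X, ∃ y ∈ Y, T x y)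
    (hc : ∃ c ∈ X, ∀ y ∈ Y, T c y) : ∀ x ∈ X, ∀ y ∈ Y, T x y := by
  classical
  have hidem : ∀ x, t (fun _ => x) = x := ht.2
  obtain ⟨ι, hι, hι', f, hf, hft⟩ := exists_transitive ht hY hYf
  -- The centers absorb X: given a neighbour b of the one arbitrary argument, transitivity reaches
  -- any y with b in that position, and centers match whatever stands elsewhere.
  have : {x ∈ X | ∀ y ∈ Y, T x y} = X := by
    refine hXf _ ⟨?_, ?_, ι, hι, hι', f, hf, fun x hx => hx.1, ?_⟩
    · obtain ⟨c, hcX, hc⟩ := hc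
      exact ⟨c, hcX, hc⟩
    · intro u hu
      refine ⟨hX u fun i => (hu i).1, fun y hy => ?_⟩
      have := hT u (fun _ => y) fun i => (hu i).2 y hy
      rwa [hidem] at this
    · intro u i hui hj
      refine ⟨hf.closedUnder hX u fun j => ?_, fun y hy => ?_⟩
      · by_cases hji : j = i
        · exact hji ▸ hui
        · exact (hj j hji).1
      · obtain ⟨b, hb, hub⟩ := htot _ hui
        obtain ⟨v, hv, hvi, rfl⟩ := hft i b hb y hy
        refine hf T hT u v fun j => ?_
        by_cases hji : j = i
        · subst hji
          rw [hvi]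
          exact hub
        · exact (hj j hji).2 _ (hv j)
  intro x hx y hy
  rw [← this] at hx
  exact hx.2 y hy

/-- A relation between absorption-free sets in which any two elements on the left have a common
neighbour is full. -/
theorem full_of_common_neighbor [Finite A] [Nonempty (Fin n)] (ht : IsTaylorOp t) {T : A → A → Prop}
    (hT : Preserves t T) {X Y : Set A} (hX : ClosedUnder t X) (hY : ClosedUnder t Y)
    (hXf : AbsFree t X) (hYf : AbsFree t Y) (htot : ∀ y ∈ Y, ∃ x ∈ X, T x y)
    (hpair : ∀ x ∈ X, ∀ x' ∈ X, ∃ y ∈ Y, T x y ∧ T x' y) : ∀ x ∈ X, ∀ y ∈ Y, T x y := by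
  classical
  have hidem : ∀ x, t (fun _ => x) = x := ht.2
  rcases X.eq_empty_or_nonempty with rfl | ⟨x₀, hx₀⟩
  · exact fun x hx => absurd hx (Set.notMem_empty x)
  have H : ∀ Z : Finset A, (∀ z ∈ Z, z ∈ X) →
      ∀ x ∈ X, ∀ x' ∈ X, ∃ y ∈ Y, T x y ∧ T x' y ∧ ∀ z ∈ Z, T z y := by
    intro Z
    induction Z using Finset.induction_on with
    | empty =>
      intro _ x hx x' hx'
      obtain ⟨y, hy, h₁, h₂⟩ := hpair x hx x' hx'
      exact ⟨y, hy, h₁, h₂, by simp⟩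
    | insert z Z hz ih =>
      intro hZ
      have hzX := hZ z (Finset.mem_insert_self z Z)
      have ih := ih fun z hz => hZ z (Finset.mem_insert_of_mem hz)
      have hc : ∀ x ∈ X, ∃ y ∈ Y, T z y ∧ T x y ∧ ∀ z' ∈ insert z Z, T z' y := by
        intro x hx
        obtain ⟨y, hy, h₁, h₂, h₃⟩ := ih z hzX x hx
        exact ⟨y, hy, h₁, h₂, by simpa using ⟨h₁, h₃⟩⟩
      -- By induction z is a center of the relation "common neighbour together with all of insert z
      -- Z" on X.
      refine full_of_center ht (T := fun x x' => ∃ y ∈ Y, T x y ∧ T x' y ∧ ∀ z' ∈ insert z Z, T z' y)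
        ?_ hX hX hXf hXf (fun x hx => ?_) ⟨z, hzX, hc⟩
      · intro u v huv
        choose w hw h₁ h₂ h₃ using huv
        refine ⟨t w, hY w hw, hT u w h₁, hT v w h₂, fun z' hz' => ?_⟩
        have := hT (fun _ => z') w fun i => h₃ i z' hz'
        rwa [hidem] at this
      · obtain ⟨y, hy, h₁, h₂, h₃⟩ := hc x hx
        exact ⟨z, hzX, y, hy, h₂, h₁, h₃⟩
  obtain ⟨y₀, hy₀, -, -, h₀⟩ := H X.toFinite.toFinset (by simp) x₀ hx₀ x₀ hx₀
  have := full_of_center ht hT.swap hY hX hYf hXf htot ⟨y₀, hy₀, fun x hx => h₀ x (by simpa using hx)⟩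
  exact fun x hx y hy => this y hy x hx

end Transitive

/-! ### Linked relations and the absorption theorem -/

/-- Two elements of `F` are adjacent if they have a common `R`-neighbour in `D`. -/
def link (R : A → A → Prop) (F D : Set A) (x y : A) : Prop :=
  x ∈ F ∧ y ∈ F ∧ ∃ z ∈ D, R x z ∧ R y z

/-- `R` restricts to a subdirect linked relation between `F` and `D`. -/
structure LinkedOn (R : A → A → Prop) (F D : Set A) : Prop where
  left : ∀ x ∈ F, ∃ z ∈ D, R x z
  right : ∀ z ∈ D, ∃ x ∈ F, R x z
  linked : ∀ x ∈ F, ∀ y ∈ F, Relation.ReflTransGen (link R F D) x y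

section Linked

variable {R : A → A → Prop} {F D : Set A}

theorem link_symm {x y : A} (h : link R F D x y) : link R F D y x := by
  obtain ⟨hx, hy, z, hz, hxz, hyz⟩ := h
  exact ⟨hy, hx, z, hz, hyz, hxz⟩

theorem reflTransGen_link_symm {x y : A} (h : Relation.ReflTransGen (link R F D) x y) :
    Relation.ReflTransGen (link R F D) y x := by
  have : Std.Symm (link R F D) := ⟨fun _ _ => link_symm⟩
  exact Relation.ReflTransGen.stdSymm.symm _ _ h

theorem LinkedOn.link_self (h : LinkedOn R F D) {x : A} (hx : x ∈ F) : link R F D x x := by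
  obtain ⟨z, hz, hxz⟩ := h.left x hx
  exact ⟨hx, hx, z, hz, hxz, hxz⟩

theorem LinkedOn.swap (h : LinkedOn R F D) : LinkedOn (fun x y => R y x) D F where
  left := h.right
  right := h.left
  linked := by
    intro d hd d' hd'
    obtain ⟨x, hx, hxd⟩ := h.right d hd
    obtain ⟨x', hx', hxd'⟩ := h.right d' hd'
    suffices H : ∀ y, Relation.ReflTransGen (link R F D) x y → ∀ e ∈ D, R y e →
        Relation.ReflTransGen (link (fun x y => R y x) D F) d e from
      H x' (h.linked x hx x' hx') d' hd' hxd'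
    intro y hy
    induction hy with
    | refl => exact fun e he hxe => .single ⟨hd, he, x, hx, hxd, hxe⟩
    | tail _ hyz ih =>
      obtain ⟨-, hz, c, hc, hyc, hzc⟩ := hyz
      exact fun e he hze => (ih c hc hyc).tail ⟨hc, he, _, hz, hzc, hze⟩

variable {κ : Type*} {t : (κ → A) → A}

theorem preserves_link (hR : Preserves t R) (hF : ClosedUnder t F) (hD : ClosedUnder t D) :
    Preserves t (link R F D) := by
  intro u v huv
  choose h₁ h₂ w hw h₃ h₄ using huv
  exact ⟨hF u h₁, hF v h₂, t w, hD w hw, hR u w h₃, hR v w h₄⟩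

variable [Finite A]

theorem LinkedOn.exists_relPow (h : LinkedOn R F D) :
    ∃ N, 0 < N ∧ ∀ x ∈ F, ∀ y ∈ F, relPow (link R F D) N x y := by
  obtain ⟨N, hN⟩ := exists_uniform_relPow (link R F D)
  exact ⟨N + 1, by omega, fun x hx y hy =>
    (hN x y (h.link_self hy) (h.linked x hx y hy)).pad (h.link_self hy) (Nat.le_succ N)⟩

/-- Some power of the reflexive link relation is full on F, and fullness descends to P by
absorption. Common neighbours of elements of P already lie in the image of P. -/
theorem LinkedOn.of_absorbs (h : LinkedOn R F D) (hR : Preserves t R) (hF : ClosedUnder t F)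
    (hD : ClosedUnder t D) (hidem : ∀ x, t (fun _ => x) = x) {P : Set A} (hP : Absorbs t P F) :
    LinkedOn R P (relImage (fun x y => R x y ∧ y ∈ D) P) := by
  have hleft : ∀ x ∈ P, ∃ z ∈ relImage (fun x y => R x y ∧ y ∈ D) P, R x z := by
    intro x hx
    obtain ⟨z, hz, hxz⟩ := h.left x (hP.subset hx)
    exact ⟨z, ⟨x, hx, hxz, hz⟩, hxz⟩
  obtain ⟨-, hPc, ι, hι, hι', f, hf, habs⟩ := hP
  have hlink : ∀ x ∈ P, ∃ y ∈ P, link R F D x y :=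
    fun x hx => ⟨x, hx, h.link_self (habs.sub hx)⟩
  refine ⟨hleft, fun z ⟨x, hx, hxz, _⟩ => ⟨x, hx, hxz⟩, fun x hx y hy => ?_⟩
  obtain ⟨N, hN, hfull⟩ := h.exists_relPow
  obtain ⟨M, -, hM⟩ := habs.exists_relPow (hf _ (preserves_link hR hF hD)) (hf.const hidem)
    (fun x y hxy => ⟨hxy.1, hxy.2.1⟩) hN hfull hlink
    fun y hy => ⟨y, hy, h.link_self (habs.sub hy)⟩
  refine Relation.ReflTransGen.mono (r := restr (link R F D) P) ?_ _ _ (hM x hx y hy).reflTransGen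
  rintro a b ⟨⟨-, -, z, hz, haz, hbz⟩, ha, hb⟩
  exact ⟨ha, hb, z, ⟨a, ha, haz, hz⟩, haz, hbz⟩

end Linked

/-- **Absorption theorem**: a linked subdirect relation between absorption-free sets is full. -/
theorem LinkedOn.full [Finite A] {n : ℕ} [Nonempty (Fin n)] {t : (Fin n → A) → A}
    (ht : IsTaylorOp t) {R : A → A → Prop} {F D : Set A} (h : LinkedOn R F D)
    (hR : Preserves t R) (hF : ClosedUnder t F) (hD : ClosedUnder t D) (hFf : AbsFree t F)
    (hDf : AbsFree t D) : ∀ x ∈ F, ∀ z ∈ D, R x z := by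
  have hW := preserves_link hR hF hD
  have H : ∀ M, (∀ x ∈ F, ∀ y ∈ F, relPow (link R F D) (M + 1) x y) →
      ∀ x ∈ F, ∀ y ∈ F, link R F D x y := by
    intro M
    induction M with
    | zero => exact fun h x hx y hy => relPow_one.1 (h x hx y hy)
    | succ M ih =>
      intro hfull
      -- Splitting off the last link of a walk from x to x' gives z; padding that link with loops at
      -- z makes z a common neighbour for the shorter power.
      refine ih (full_of_common_neighbor ht (hW.relPow (M + 1)) hF hF hFf hFf
        (fun y hy => ⟨y, hy, ?_⟩) fun x hx x' hx' => ?_)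
      · exact relPow.pad (h.link_self hy) (Nat.zero_le _) rfl
      · obtain ⟨z, hxz, hzx'⟩ := hfull x hx x' hx'
        refine ⟨z, hzx'.1, hxz, ?_⟩
        exact (relPow_one.2 (link_symm hzx')).pad (h.link_self hzx'.1) (by omega)
  obtain ⟨N, hN, hfull⟩ := h.exists_relPow
  obtain ⟨M, rfl⟩ : ∃ M, N = M + 1 := ⟨N - 1, by omega⟩
  refine full_of_common_neighbor ht hR hF hD hFf hDf h.right fun x hx x' hx' => ?_
  exact (H M hfull x hx x' hx').2.2

/-! ### Passing to a proper subset -/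

section Core

variable {n : ℕ} {t : (Fin n → A) → A} {E : A → A → Prop}

theorem eq_of_isTaylorOp_zero {t : (Fin 0 → A) → A} (ht : IsTaylorOp t) (x y : A) : x = y := by
  rw [← ht.2 x, ← ht.2 y]
  congr 1
  exact funext fun i => i.elim0

/-- A proper absorbing subset yields a proper closed subset with walks of one common length. -/
theorem exists_subset_of_absorbs [Finite A] (hidem : ∀ x, t (fun _ => x) = x)
    (hE : Preserves t E) {N : ℕ} (hN : 0 < N) (hfull : ∀ x y, relPow E N x y) {P : Set A}
    (hP : Absorbs t P Set.univ) (hne : P ≠ Set.univ) :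
    ∃ K : Set A, K.Nonempty ∧ ClosedUnder t K ∧ K ≠ Set.univ ∧
      ∃ M, 0 < M ∧ ∀ x ∈ K, ∀ y ∈ K, relPow (restr E K) M x y := by
  obtain ⟨hPne, hPc, ι, hι, hι', f, hf, habs⟩ := hP
  have hsucc : ∀ x, ∃ y, E x y := by
    intro x
    obtain ⟨M, rfl⟩ : ∃ M, N = M + 1 := ⟨N - 1, by omega⟩
    rw [add_comm] at hfull
    obtain ⟨y, hy, -⟩ := exists_of_relPow_add (hfull x x)
    exact ⟨y, relPow_one.1 hy⟩
  have hpred : ∀ y, ∃ x, E x y := by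
    intro x
    obtain ⟨M, rfl⟩ : ∃ M, N = M + 1 := ⟨N - 1, by omega⟩
    obtain ⟨y, -, hy⟩ := hfull x x
    exact ⟨y, hy⟩
  obtain ⟨C, ⟨hCne, hCc, hCabs, hCuniv⟩, hC⟩ : ∃ C : Set A,
      (C.Nonempty ∧ ClosedUnder t C ∧ AbsorbsVia f C Set.univ ∧ C ≠ Set.univ) ∧
        relImage E C = Set.univ := by
    by_contra! hcon
    -- Otherwise the iterated images of P would stay proper forever, although E^N[P] is everything.
    have : ∀ k, ∃ C : Set A, (C.Nonempty ∧ ClosedUnder t C ∧ AbsorbsVia f C Set.univ ∧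
        C ≠ Set.univ) ∧ ∀ x ∈ P, ∀ y, relPow E k x y → y ∈ C := by
      intro k
      induction k with
      | zero => exact ⟨P, ⟨hPne, hPc, habs, hne⟩, fun x hx y hxy => hxy ▸ hx⟩
      | succ k ih =>
        obtain ⟨C, hC, hPC⟩ := ih
        refine ⟨relImage E C, ⟨?_, hE.image hC.2.1, ?_, hcon C hC⟩, ?_⟩
        · obtain ⟨x, hx⟩ := hC.1
          obtain ⟨y, hy⟩ := hsucc x
          exact ⟨y, x, hx, hy⟩
        · have := hC.2.2.1.image (hf E hE)
          rwa [show relImage E Set.univ = Set.univ from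
            Set.eq_univ_of_forall fun y => by
              obtain ⟨x, hx⟩ := hpred y; exact ⟨x, trivial, hx⟩] at this
        · rintro x hx y ⟨z, hz, hzy⟩
          exact ⟨z, hPC x hx z hz, hzy⟩
    obtain ⟨C, hC, hPC⟩ := this N
    obtain ⟨x, hx⟩ := hPne
    exact hC.2.2.2 (Set.eq_univ_of_forall fun y => hPC x hx y (hfull x y))
  obtain ⟨K, hKC, ⟨hKc, hKabs⟩, hKne, hKpred, hKsucc⟩ := exists_smooth_subset E
    (fun K => ClosedUnder t K ∧ AbsorbsVia f K Set.univ) (fun K hK _ => by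
      have huniv : relImage (fun x y => E y x) Set.univ = Set.univ :=
        Set.eq_univ_of_forall fun y => by
          obtain ⟨x, hx⟩ := hsucc y; exact ⟨x, trivial, hx⟩
      have h := hK.2.image (hf _ hE.swap)
      rw [huniv] at h
      refine ⟨hK.1.inter (hE.swap.image hK.1), fun x _ => trivial, fun u i _ hj => ?_⟩
      exact ⟨hK.2.absorb u i trivial fun j hji => (hj j hji).1,
        h.absorb u i trivial fun j hji => (hj j hji).2⟩)
    ⟨hCc, hCabs⟩ hCne (fun y _ => by
      have : y ∈ relImage E C := hC ▸ Set.mem_univ y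
      exact this)
  refine ⟨K, hKne, hKc, fun h => hCuniv (Set.univ_subset_iff.1 (h ▸ hKC)), ?_⟩
  exact hKabs.exists_relPow (hf E hE) (hf.const hidem) (fun _ _ _ => ⟨trivial, trivial⟩) hN
    (fun x _ y _ => hfull x y) hKsucc hKpred

/-- The data carried along when shrinking a linked block to absorption-free parts. -/
structure GoodPair (t : (Fin n → A) → A) (E S : A → A → Prop) (F D : Set A) : Prop where
  nonempty_left : F.Nonempty
  nonempty_right : D.Nonempty
  closed_left : ClosedUnder t F
  closed_right : ClosedUnder t D
  linked : LinkedOn S F D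
  succ_left : ∀ x, ∃ y ∈ F, E x y
  pred_right : ∀ y, ∃ x ∈ D, E x y

theorem GoodPair.swap {S : A → A → Prop} {F D : Set A} (h : GoodPair t E S F D) :
    GoodPair t (fun x y => E y x) (fun x y => S y x) D F :=
  ⟨h.nonempty_right, h.nonempty_left, h.closed_right, h.closed_left, h.linked.swap, h.pred_right,
    h.succ_left⟩

/-- The preimage of P under E absorbs that of F, which is all of A; as A is absorption-free, it is
all of A too. The same works for images of the right side. -/
theorem GoodPair.of_absorbs [Finite A] {S : A → A → Prop} {F D : Set A} (h : GoodPair t E S F D)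
    (hidem : ∀ x, t (fun _ => x) = x) (hE : Preserves t E) (hS : Preserves t S)
    (hfree : AbsFree t (Set.univ : Set A)) {P : Set A} (hP : Absorbs t P F) :
    ∃ D' ⊆ D, GoodPair t E S P D' := by
  have hl := h.linked.of_absorbs hS h.closed_left h.closed_right hidem hP
  set R : A → A → Prop := fun x y => S x y ∧ y ∈ D with hRdef
  have hR : Preserves t R := fun u v huv =>
    ⟨hS u v fun i => (huv i).1, h.closed_right v fun i => (huv i).2⟩
  have hne : (relImage R P).Nonempty := by
    obtain ⟨x, hx⟩ := hP.1
    obtain ⟨z, hz, -⟩ := hl.left x hx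
    exact ⟨z, hz⟩
  have hRF : relImage R F = D := by
    refine Set.Subset.antisymm (fun z ⟨x, _, hz⟩ => hz.2) fun z hz => ?_
    obtain ⟨x, hx, hxz⟩ := h.linked.right z hz
    exact ⟨x, hx, hxz, hz⟩
  have hRP : Absorbs t (relImage R P) D := hRF ▸ hP.image hR hne
  refine ⟨relImage R P, hRP.subset, hP.1, hne, hP.2.1, hRP.2.1, hl, ?_, ?_⟩
  · have huniv : relImage (fun x y => E y x) P = Set.univ := by
      refine hfree.eq_univ_of_image hE.swap hP (Set.eq_univ_of_forall h.succ_left) ?_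
      obtain ⟨y, hy⟩ := hP.1
      obtain ⟨x, -, hxy⟩ := h.pred_right y
      exact ⟨x, y, hy, hxy⟩
    intro x
    have : x ∈ relImage (fun x y => E y x) P := huniv ▸ Set.mem_univ x
    exact this
  · have huniv : relImage E (relImage R P) = Set.univ := by
      refine hfree.eq_univ_of_image hE hRP (Set.eq_univ_of_forall h.pred_right) ?_
      obtain ⟨y, hy⟩ := hne
      obtain ⟨x, -, hxy⟩ := h.succ_left y
      exact ⟨x, y, hy, hxy⟩
    intro x
    have : x ∈ relImage E (relImage R P) := huniv ▸ Set.mem_univ x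
    exact this

theorem GoodPair.exists_absFree [Finite A] {S : A → A → Prop} {F D : Set A}
    (h : GoodPair t E S F D) (hidem : ∀ x, t (fun _ => x) = x) (hE : Preserves t E)
    (hS : Preserves t S) (hfree : AbsFree t (Set.univ : Set A)) :
    ∃ F' ⊆ F, ∃ D' ⊆ D, GoodPair t E S F' D' ∧ AbsFree t F' ∧ AbsFree t D' := by
  induction hm : F.ncard + D.ncard using Nat.strong_induction_on generalizing F D with
  | _ m ih =>
    by_cases hF : AbsFree t F
    · by_cases hD : AbsFree t D
      · exact ⟨F, subset_rfl, D, subset_rfl, h, hF, hD⟩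
      · unfold AbsFree at hD
        push Not at hD
        obtain ⟨P, hP, hPD⟩ := hD
        obtain ⟨F', hF', hgood⟩ := h.swap.of_absorbs hidem hE.swap hS.swap hfree hP
        have h₁ : P.ncard < D.ncard := Set.ncard_lt_ncard (hP.subset.ssubset_of_ne hPD)
        have h₂ := Set.ncard_le_ncard hF'
        obtain ⟨F'', hF'', D'', hD'', hrest⟩ := ih _ (by omega) hgood.swap rfl
        exact ⟨F'', hF''.trans hF', D'', hD''.trans hP.subset, hrest⟩
    · unfold AbsFree at hF
      push Not at hF
      obtain ⟨P, hP, hPF⟩ := hF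
      obtain ⟨D', hD', hgood⟩ := h.of_absorbs hidem hE hS hfree hP
      have h₁ : P.ncard < F.ncard := Set.ncard_lt_ncard (hP.subset.ssubset_of_ne hPF)
      have h₂ := Set.ncard_le_ncard hD'
      obtain ⟨F'', hF'', D'', hD'', hrest⟩ := ih _ (by omega) hgood rfl
      exact ⟨F'', hF''.trans hP.subset, D'', hD''.trans hD', hrest⟩

/-- A vertex with closed walks of two consecutive lengths inside a closed set generates a closed
strong component with walks of one common length. -/
theorem exists_component [Finite A] (hidem : ∀ x, t (fun _ => x) = x) (hE : Preserves t E)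
    {Y : Set A} (hY : ClosedUnder t Y) {d : A} (hd : d ∈ Y) {k : ℕ}
    (h₁ : relPow (restr E Y) k d d) (h₂ : relPow (restr E Y) (k + 1) d d) :
    ∃ X ⊆ Y, X.Nonempty ∧ ClosedUnder t X ∧
      ∃ M, 0 < M ∧ ∀ x ∈ X, ∀ y ∈ X, relPow (restr E X) M x y := by
  set H := restr E Y with hH
  have hHt : Preserves t H := hE.restr hY
  obtain ⟨N, hN, hfull⟩ := exists_common_length H d (by
    have h := Nat.setGcd_dvd_of_mem (s := {m | relPow H m d d}) h₁
    exact Nat.dvd_one.1 ((Nat.dvd_add_right h).1 (Nat.setGcd_dvd_of_mem h₂)))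
  -- Describing the component by walks of the fixed length N shows that it is t-closed.
  have hX : {x | Relation.ReflTransGen H x d ∧ Relation.ReflTransGen H d x}
      = {x | relPow H N x d} ∩ {x | relPow H N d x} := by
    ext x
    exact ⟨fun h => ⟨hfull x d h.1 .refl, hfull d x .refl h.2⟩,
      fun h => ⟨h.1.reflTransGen, h.2.reflTransGen⟩⟩
  refine ⟨{x | Relation.ReflTransGen H x d ∧ Relation.ReflTransGen H d x}, ?_,
    ⟨d, .refl, .refl⟩, ?_, N, hN, fun x hx y hy => ?_⟩
  · rintro x ⟨-, hx⟩
    rcases Relation.ReflTransGen.cases_tail hx with h | ⟨z, -, hz⟩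
    · exact h ▸ hd
    · exact hz.2.2
  · rw [hX]
    exact ((hHt.relPow N).swap.closedUnder_image hidem d).inter
      ((hHt.relPow N).closedUnder_image hidem d)
  · refine relPow.mono (fun a b hab => ⟨hab.1.1, hab.2⟩)
      (relPow.restr (fun i z _ hxz hzy => ?_) (hfull x y hx.1 hy.2))
    exact ⟨hzy.reflTransGen.trans hy.1, hx.2.trans hxz.reflTransGen⟩

/-- Without proper absorbing subsets, there is a loop or a proper closed subset with walks of one
common length. -/
theorem exists_loop_or_subset [Finite A] [Nonempty A] [Nonempty (Fin n)] (ht : IsTaylorOp t)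
    (hE : Preserves t E) {N : ℕ} (hN : 0 < N) (hfull : ∀ x y, relPow E N x y)
    (hfree : AbsFree t (Set.univ : Set A)) :
    (∃ a, E a a) ∨ ∃ K : Set A, K.Nonempty ∧ ClosedUnder t K ∧ K ≠ Set.univ ∧
      ∃ M, 0 < M ∧ ∀ x ∈ K, ∀ y ∈ K, relPow (restr E K) M x y := by
  classical
  have hidem : ∀ x, t (fun _ => x) = x := ht.2
  obtain ⟨a⟩ := ‹Nonempty A›
  have hsmooth : (∀ x, ∃ y, E x y) ∧ ∀ y, ∃ x, E x y := by
    obtain ⟨M, rfl⟩ : ∃ M, N = M + 1 := ⟨N - 1, by omega⟩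
    refine ⟨fun x => ?_, fun y => ?_⟩
    · rw [add_comm] at hfull
      obtain ⟨y, hy, -⟩ := exists_of_relPow_add (hfull x x)
      exact ⟨y, relPow_one.1 hy⟩
    · obtain ⟨x, -, hx⟩ := hfull y y
      exact ⟨x, hx⟩
  have hex : ∃ k, 0 < k ∧ ∀ x y, relPow E k x y := ⟨N, hN, hfull⟩
  obtain ⟨hk, hkfull⟩ := Nat.find_spec hex
  have hmin : ∀ m, m < Nat.find hex → ¬ (0 < m ∧ ∀ x y, relPow E m x y) := fun m hm =>
    Nat.find_min hex hm
  generalize Nat.find hex = k at hk hkfull hmin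
  obtain ⟨s, rfl⟩ : ∃ s, k = s + 1 := ⟨k - 1, by omega⟩
  rcases Nat.eq_zero_or_pos s with rfl | hs
  · exact .inl ⟨a, relPow_one.1 (hkfull a a)⟩
  right
  have hSt : Preserves t (relPow E s) := hE.relPow s
  have hSfull : ¬ ∀ x y, relPow E s x y := fun h => hmin s (Nat.lt_succ_self s) ⟨hs, h⟩
  set S := relPow E s with hSdef
  have hSleft : ∀ x, ∃ z, S x z := by
    intro x
    obtain ⟨z, -, hz⟩ := exists_relPow_to (E := E) Set.univ
      (fun x _ => by obtain ⟨y, hy⟩ := hsmooth.1 x; exact ⟨y, trivial, hy⟩) s x trivial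
    exact ⟨z, hz.mono fun _ _ h => h.1⟩
  have hSright : ∀ z, ∃ x, S x z := by
    intro z
    obtain ⟨x, -, hx⟩ := exists_relPow_from (E := E) Set.univ
      (fun x _ => by obtain ⟨y, hy⟩ := hsmooth.2 x; exact ⟨y, trivial, hy⟩) s z trivial
    exact ⟨x, hx.mono fun _ _ h => h.1⟩
  have huniv : ClosedUnder t (Set.univ : Set A) := fun _ _ => trivial
  set W := link S Set.univ Set.univ with hW
  have hWt : Preserves t W := preserves_link hSt huniv huniv
  have hWrefl : ∀ x, W x x := by
    intro x
    obtain ⟨z, hz⟩ := hSleft x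
    exact ⟨trivial, trivial, z, trivial, hz, hz⟩
  set L : Set A := {x | Relation.ReflTransGen W a x} with hL
  set C : Set A := relImage S L with hC
  have hLc : ClosedUnder t L := by
    obtain ⟨M, hM⟩ := exists_uniform_relPow W
    have : L = {x | relPow W M a x} :=
      Set.ext fun x => ⟨fun h => hM a x (hWrefl x) h, fun h => h.reflTransGen⟩
    rw [this]
    exact (hWt.relPow M).closedUnder_image hidem a
  have hCc : ClosedUnder t C := hSt.image hLc
  have hback : ∀ x z, S x z → z ∈ C → x ∈ L := by
    rintro x z hxz ⟨y, hy, hyz⟩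
    exact hy.tail ⟨trivial, trivial, z, trivial, hyz, hxz⟩
  have hLne : L ≠ Set.univ := by
    intro h
    refine hSfull fun x y => ?_
    have hlinked : LinkedOn S Set.univ Set.univ := by
      refine ⟨fun x _ => ?_, fun z _ => ?_, fun x _ y _ => ?_⟩
      · obtain ⟨z, hz⟩ := hSleft x
        exact ⟨z, trivial, hz⟩
      · obtain ⟨x, hx⟩ := hSright z
        exact ⟨x, trivial, hx⟩
      · have hx : x ∈ L := h ▸ Set.mem_univ x
        have hy : y ∈ L := h ▸ Set.mem_univ y
        exact (reflTransGen_link_symm hx).trans hy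
    exact hlinked.full ht hSt huniv huniv hfree hfree x trivial y trivial
  have hgood : GoodPair t E S L C := by
    have haL : a ∈ L := .refl
    obtain ⟨c, hac⟩ := hSleft a
    have hcC : c ∈ C := ⟨a, haL, hac⟩
    refine ⟨⟨a, haL⟩, ⟨c, hcC⟩, hLc, hCc, ⟨fun x hx => ?_, fun z hz => hz, fun x hx y hy => ?_⟩,
      fun x => ?_, fun y => ?_⟩
    · obtain ⟨z, hz⟩ := hSleft x
      exact ⟨z, ⟨x, hx, hz⟩, hz⟩
    · have key : ∀ y, Relation.ReflTransGen W a y →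
          Relation.ReflTransGen (link S L C) a y := by
        intro y hy
        induction hy with
        | refl => exact .refl
        | tail hb hbc ih =>
          obtain ⟨-, -, z, -, hbz, hcz⟩ := hbc
          have hz : z ∈ C := ⟨_, hb, hbz⟩
          exact ih.tail ⟨hb, hback _ z hcz hz, z, hz, hbz, hcz⟩
      exact (reflTransGen_link_symm (key x hx)).trans (key y hy)
    · have := hkfull x c
      rw [add_comm] at this
      obtain ⟨y, hxy, hyc⟩ := exists_of_relPow_add this
      exact ⟨y, hback y c hyc hcC, relPow_one.1 hxy⟩
    · obtain ⟨z, haz, hzy⟩ := hkfull a y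
      exact ⟨z, ⟨a, haL, haz⟩, hzy⟩
  obtain ⟨F, hFL, D, hDC, hFD, hFf, hDf⟩ := hgood.exists_absFree hidem hE hSt hfree
  have hFDS : ∀ x ∈ F, ∀ z ∈ D, S x z :=
    hFD.linked.full ht hSt hFD.closed_left hFD.closed_right hFf hDf
  obtain ⟨K, hKD, -, ⟨d, hd⟩, hKpred, hKsucc⟩ := exists_smooth_subset E (fun _ => True)
    (fun _ _ _ => trivial) trivial hFD.nonempty_right fun y _ => hFD.pred_right y
  have hKC : K ⊆ C := hKD.trans hDC
  have hKL : K ⊆ L := by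
    intro x hx
    obtain ⟨z, hz, hxz⟩ := exists_relPow_to K hKsucc s x hx
    exact hback x z (hxz.mono fun _ _ h => h.1) (hKC hz)
  -- Having walks of every length from L puts a vertex in C (length s), and so do its continuations.
  have hstep : ∀ x y, (∀ j, ∃ w ∈ L, relPow E j w x) → E x y → y ∈ L →
      ∀ j, ∃ w ∈ L, relPow E j w y := by
    intro x y hx hxy hy j
    cases j with
    | zero => exact ⟨y, hy, rfl⟩
    | succ j =>
      obtain ⟨w, hw, hwx⟩ := hx j
      exact ⟨w, hw, x, hwx, hxy⟩
  have hwalk : ∀ x, (∀ j, ∃ w ∈ L, relPow E j w x) → x ∈ F →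
      relPow (restr E (L ∩ C)) s x d := by
    intro x hx hxF
    -- Prolonging the walk beyond d inside K shows z ∈ L; prolonging it backwards from x to a start
    -- in L shows z ∈ C.
    refine relPow.restr (fun i z hi hxz hzd => ?_) (hFDS x hxF d (hKD hd))
    constructor
    · obtain ⟨c, hc, hdc⟩ := exists_relPow_to K hKsucc i d hd
      refine hback z c ?_ (hKC hc)
      have := relPow_add hzd (hdc.mono fun _ _ h => h.1)
      rwa [Nat.sub_add_cancel hi] at this
    · obtain ⟨w, hw, hwx⟩ := hx (s - i)
      refine ⟨w, hw, ?_⟩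
      have := relPow_add hwx hxz
      rwa [Nat.sub_add_cancel hi] at this
  have hβd : ∀ j, ∃ w ∈ L, relPow E j w d := by
    intro j
    obtain ⟨c, hc, hcd⟩ := exists_relPow_from K hKpred j d hd
    exact ⟨c, hKL hc, hcd.mono fun _ _ h => h.1⟩
  obtain ⟨f₁, hf₁, hdf⟩ := hFD.succ_left d
  obtain ⟨f₂, hf₂, hff⟩ := hFD.succ_left f₁
  have hβ₁ := hstep d f₁ hβd hdf (hFL hf₁)
  have hβ₂ := hstep f₁ f₂ hβ₁ hff (hFL hf₂)
  have hdm : d ∈ L ∩ C := ⟨hKL hd, hKC hd⟩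
  have h₁m : f₁ ∈ L ∩ C := ⟨hFL hf₁, hβ₁ s⟩
  have h₂m : f₂ ∈ L ∩ C := ⟨hFL hf₂, hβ₂ s⟩
  have e₁ : restr E (L ∩ C) d f₁ := ⟨hdf, hdm, h₁m⟩
  have e₂ : restr E (L ∩ C) f₁ f₂ := ⟨hff, h₁m, h₂m⟩
  -- The two closed walks d → f₁ ⇝ d and d → f₁ → f₂ ⇝ d have lengths s + 1 and s + 2.
  obtain ⟨X, hXs, hXne, hXc, hX⟩ := exists_component hidem hE (hLc.inter hCc) hdm
    (relPow_cons e₁ (hwalk f₁ hβ₁ hf₁)) (relPow_cons e₁ (relPow_cons e₂ (hwalk f₂ hβ₂ hf₂)))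
  exact ⟨X, hXne, hXc, fun h => hLne (Set.univ_subset_iff.1 (h ▸ hXs.trans Set.inter_subset_left)),
    hX⟩

theorem relPow_subtype {P : Set A} {k : ℕ} {x y : P} (h : relPow (restr E P) k x y) :
    relPow (fun x y : P => E x y) k x y := by
  induction k generalizing y with
  | zero => exact Subtype.ext h
  | succ k ih =>
    obtain ⟨z, hz, hzy⟩ := h
    exact ⟨⟨z, hzy.2.1⟩, ih (y := ⟨z, hzy.2.1⟩) hz, hzy.1⟩

end Core

/-! ### Induction on the number of vertices and conclusion -/

/-- The loop lemma for digraphs in which walks of one common length join all vertices. -/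
theorem exists_loop_of_common_length {A : Type*} [Finite A] [Nonempty A] {n : ℕ}
    {t : (Fin n → A) → A} {E : A → A → Prop} (ht : IsTaylorOp t) (hE : Preserves t E)
    {N : ℕ} (hN : 0 < N) (hfull : ∀ x y, relPow E N x y) : ∃ a, E a a := by
  induction hm : Nat.card A using Nat.strong_induction_on generalizing A N with
  | _ m ih =>
    have hidem : ∀ x, t (fun _ => x) = x := ht.2
    rcases n with _ | n
    · obtain ⟨a⟩ := ‹Nonempty A›
      obtain ⟨M, rfl⟩ : ∃ M, N = M + 1 := ⟨N - 1, by omega⟩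
      obtain ⟨z, -, hz⟩ := hfull a a
      exact ⟨a, eq_of_isTaylorOp_zero ht z a ▸ hz⟩
    have key : (∃ a, E a a) ∨ ∃ K : Set A, K.Nonempty ∧ ClosedUnder t K ∧ K ≠ Set.univ ∧
        ∃ M, 0 < M ∧ ∀ x ∈ K, ∀ y ∈ K, relPow (restr E K) M x y := by
      by_cases hfree : AbsFree t (Set.univ : Set A)
      · exact exists_loop_or_subset ht hE hN hfull hfree
      · unfold AbsFree at hfree
        push Not at hfree
        obtain ⟨P, hP, hne⟩ := hfree
        exact .inr (exists_subset_of_absorbs hidem hE hN hfull hP hne)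
    rcases key with h | ⟨K, hKne, hKc, hKuniv, M, hM, hK⟩
    · exact h
    have := hKne.to_subtype
    let t' : (Fin (n + 1) → K) → K := fun u => ⟨t fun i => u i, hKc _ fun i => (u i).2⟩
    have ht' : IsTaylorOp t' := by
      obtain ⟨⟨l, r, hl, hr, heq⟩, -⟩ := ht
      refine ⟨⟨l, r, hl, hr, fun i x y => Subtype.ext ?_⟩, fun x => Subtype.ext (hidem x)⟩
      have := heq i x y
      simpa only [t', apply_ite Subtype.val] using this
    have hcard : Nat.card K < m := by
      rw [← hm, Nat.card_coe_set_eq, ← Set.ncard_univ]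
      exact Set.ncard_lt_ncard (Set.ssubset_univ_iff.2 hKuniv)
    obtain ⟨a, ha⟩ := ih _ hcard (A := K) (t := t') (E := fun x y => E x y) ht'
      (fun u v huv => hE _ _ huv) hM (fun x y => relPow_subtype (hK x x.2 y y.2)) rfl
    exact ⟨a, ha⟩

/-- In a strongly connected digraph of algebraic length `1` the closed walks through any vertex
have coprime lengths. -/
theorem setGcd_closed_walks_eq_one {A : Type*} {G : Digraph A} (hconn : StronglyConnected G)
    (hlen : HasAlgebraicLengthOne G) (a : A) : Nat.setGcd {m | relPow G.Adj m a a} = 1 := by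
  by_contra hne
  obtain ⟨m, hm, hdvd⟩ : ∃ m, 1 < m ∧ m ∣ Nat.setGcd {m | relPow G.Adj m a a} := by
    rcases Nat.eq_zero_or_pos (Nat.setGcd {m | relPow G.Adj m a a}) with h | h
    -- The gcd is 0 if only the trivial closed walk exists; any modulus then works.
    · exact ⟨2, by norm_num, h ▸ dvd_zero 2⟩
    · exact ⟨_, by omega, dvd_rfl⟩
  refine hlen m hm ?_
  choose p hp using fun v => exists_relPow_of_reflTransGen (hconn a v)
  -- Walk length from a, modulo m, is a homomorphism: closing both walks to v by the same return
  -- walk q shows p v ≡ p u + 1.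
  refine ⟨fun v => (p v : ZMod m), fun u v huv => ?_⟩
  obtain ⟨q, hq⟩ := exists_relPow_of_reflTransGen (hconn v a)
  have hclosed : ∀ k, relPow G.Adj k a a → (k : ZMod m) = 0 := fun k hk =>
    (ZMod.natCast_eq_zero_iff k m).2 (hdvd.trans (Nat.setGcd_dvd_of_mem hk))
  have h₁ := hclosed _ (relPow_add (hp v) hq)
  have h₂ := hclosed _ (relPow_add (n := q) (m := p u + 1) ⟨u, hp u, huv⟩ hq)
  push_cast at h₁ h₂
  change (p v : ZMod m) = p u + 1
  linear_combination h₁ - h₂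

end LoopLemma

theorem mainTheorem7 {A : Type*} [Finite A] (G : Digraph A) {n : ℕ} (t : (Fin n → A) → A)
    (hconn : LoopLemma.StronglyConnected G)
    (hlen : LoopLemma.HasAlgebraicLengthOne G)
    (htaylor : LoopLemma.IsTaylorOp t)
    (hcomp : LoopLemma.Compatible G t) :
    LoopLemma.HasLoop G := by
  rcases isEmpty_or_nonempty A with hA | ⟨⟨a⟩⟩
  -- The empty digraph maps to every directed cycle, so it does not have algebraic length 1.
  · exact absurd ⟨fun x => (hA.false x).elim, fun x => (hA.false x).elim⟩ (hlen 2 (by norm_num))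
  have : Nonempty A := ⟨a⟩
  obtain ⟨N, hN, hfull⟩ := LoopLemma.exists_common_length G.Adj a
    (LoopLemma.setGcd_closed_walks_eq_one hconn hlen a)
  exact LoopLemma.exists_loop_of_common_length htaylor hcomp hN
    fun x y => hfull x y (hconn x a) (hconn a y)
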